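/- Let $V$ be a symmetric positive definite $p\times p$ matrix, let $\mathcal C=\{\mu\in\mathbb R^p: A\mu\ge 0\}$ be a polyhedral cone (with $A$ a real matrix with finitely many rows), and let $0<\alpha<1$. Write $\|x\|_V^2=x^TV^{-1}x$, let $\Pi_V(y|\mathcal C)$ be the unique point of $\mathcal C$ minimizing $\mu\mapsto\|y-\mu\|_V^2$ over $\mathcal C$, and let $\mathcal C^{o}=\{x\in\mathbb R^p: x^TV^{-1}y\le 0 \text{ for all } y\in\mathcal C\}$ be the polar cone of $\mathcal C$ for the inner product $x^TV^{-1}y$. To test $H_0:\mu=0$ against $H_1:\mu\in\mathcal C$ from $Y\sim\mathcal N(\mu,V)$, consider the likelihood ratio statistic \[ LR(y)=y^TV^{-1}y-\min_{\mu\in\mathcal C}(y-\mu)^TV^{-1}(y-\mu). \] Let $F_1,\dots,F_K$ be the (nonempty) faces of $\mathcal C$, whose relative interiors $ri(F_i)$ partition $\mathcal C$; let $r_i=\dim\operatorname{span}(F_i)$, that is, the rank of the projection matrix onto $\operatorname{span}(F_i)$; let $q_{\chi^2(r)}(1-\alpha)$ be the $(1-\alpha)$-quantile of the chi-square distribution with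 $r$ degrees of freedom (the point mass at $0$ if $r=0$); and define the data-dependent critical value \[ q(\mathcal C,y,\alpha)=\sum_{i=1}^K \mathbf 1\{\Pi_V(y|\mathcal C)\in ri(F_i)\}\, q_{\chi^2(r_i)}(1-\alpha). \] Then $LR(y)=\|\Pi_V(y|\mathcal C)\|_V^2$ for every $y\in\mathbb R^p$, and if $Y\sim\mathcal N(0,V)$ (that is, under $H_0$), \[ \mathbb P_{H_0}\bigl(LR(Y)>q(\mathcal C,Y,\alpha)\bigr)\le\bigl(1-\mathbb P_{H_0}(Y\in\mathcal C^{o})\bigr)\,\alpha\le\alpha. \] -/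

import Mathlib

open MeasureTheory ProbabilityTheory
open scoped Matrix

namespace ConeTest

noncomputable section

/-- `C` is a polyhedral cone: `C = {μ : a₁ᵀμ ≥ 0, …, aₖᵀμ ≥ 0} = {μ : A μ ≥ 0}`. -/
def IsPolyhedralCone {p : ℕ} (C : PointedCone ℝ (EuclideanSpace ℝ (Fin p))) : Prop :=
  ∃ (k : ℕ) (A : Matrix (Fin k) (Fin p) ℝ), ∀ x, x ∈ C ↔ ∀ i, 0 ≤ (A *ᵥ x.ofLp) i

/-- The inner product `xᵀ V⁻¹ y`. -/
def innerV {p : ℕ} (V : Matrix (Fin p) (Fin p) ℝ) (x y : EuclideanSpace ℝ (Fin p)) : ℝ :=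
  x.ofLp ⬝ᵥ (V⁻¹ *ᵥ y.ofLp)

/-- The squared norm `‖x‖²_V = xᵀ V⁻¹ x`. -/
def normSqV {p : ℕ} (V : Matrix (Fin p) (Fin p) ℝ) (x : EuclideanSpace ℝ (Fin p)) : ℝ :=
  innerV V x x

/-- `z` is a point of `C` closest to `y` in the norm `‖·‖_V`. -/
def IsProjV {p : ℕ} (V : Matrix (Fin p) (Fin p) ℝ)
    (C : PointedCone ℝ (EuclideanSpace ℝ (Fin p))) (y z : EuclideanSpace ℝ (Fin p)) : Prop :=
  z ∈ C ∧ ∀ w ∈ C, normSqV V (y - z) ≤ normSqV V (y - w)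

/-- The projection `Π_V(y | C)` for the norm `‖·‖_V`. For positive definite `V` and polyhedral `C`
it exists and is unique, see `existsUnique_isProjV`. -/
def projV {p : ℕ} (V : Matrix (Fin p) (Fin p) ℝ)
    (C : PointedCone ℝ (EuclideanSpace ℝ (Fin p))) (y : EuclideanSpace ℝ (Fin p)) :
    EuclideanSpace ℝ (Fin p) :=
  Classical.epsilon (IsProjV V C y)

/-- The polar cone `C° = {x : xᵀ V⁻¹ y ≤ 0 for all y ∈ C}` for the inner product of `‖·‖_V`. -/
def polarV {p : ℕ} (V : Matrix (Fin p) (Fin p) ℝ)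
    (C : PointedCone ℝ (EuclideanSpace ℝ (Fin p))) : Set (EuclideanSpace ℝ (Fin p)) :=
  {x | ∀ y ∈ C, innerV V x y ≤ 0}

/-- The likelihood ratio statistic `yᵀV⁻¹y - min_{μ ∈ C} (y - μ)ᵀV⁻¹(y - μ)`. -/
def lrStat {p : ℕ} (V : Matrix (Fin p) (Fin p) ℝ)
    (C : PointedCone ℝ (EuclideanSpace ℝ (Fin p))) (y : EuclideanSpace ℝ (Fin p)) : ℝ :=
  normSqV V y - ⨅ μ : C, normSqV V (y - μ)

/-- The chi-square distribution with `r` degrees of freedom: the law of `‖Z‖²` for a standard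
Gaussian vector `Z` in `ℝʳ`; for `r = 0` it is the point mass at `0`. -/
def chiSquare (r : ℕ) : Measure ℝ :=
  (stdGaussian (EuclideanSpace ℝ (Fin r))).map (fun z ↦ ‖z‖ ^ 2)

/-- The quantile of order `t` of a distribution on `ℝ`, for `0 < t < 1`. -/
def quantile (ν : Measure ℝ) (t : ℝ) : ℝ :=
  sInf {x : ℝ | t ≤ cdf ν x}

open Classical in
/-- The random critical value: the sum over all faces `F` of `C` of the indicator of
`Π_V(y | C) ∈ ri F` times the `(1 - α)`-quantile of the chi-square distribution with
`dim span F` degrees of freedom. Exactly one summand has indicator `1`, see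
`existsUnique_face`. -/
def critVal {p : ℕ} (V : Matrix (Fin p) (Fin p) ℝ)
    (C : PointedCone ℝ (EuclideanSpace ℝ (Fin p))) (α : ℝ) (y : EuclideanSpace ℝ (Fin p)) : ℝ :=
  ∑ᶠ F : {F : PointedCone ℝ (EuclideanSpace ℝ (Fin p)) // F.IsFaceOf C},
    if projV V C y ∈ intrinsicInterior ℝ (F.1 : Set (EuclideanSpace ℝ (Fin p))) then
      quantile (chiSquare (Module.finrank ℝ
        (Submodule.span ℝ (F.1 : Set (EuclideanSpace ℝ (Fin p)))))) (1 - α)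
    else 0

theorem normSqV_eq {p : ℕ} {V : Matrix (Fin p) (Fin p) ℝ} (hV : V.PosDef) :
    ∃ L : EuclideanSpace ℝ (Fin p) ≃L[ℝ] EuclideanSpace ℝ (Fin p),
      ∀ x, normSqV V x = ‖L x‖ ^ 2 := by
  open scoped MatrixOrder in
  obtain ⟨B, hB⟩ := CStarAlgebra.nonneg_iff_eq_star_mul_self.mp hV.inv.posSemidef.nonneg
  have h0 : ∀ x, normSqV V x = ‖Matrix.toEuclideanLin B x‖ ^ 2 := by
    intro x
    rw [EuclideanSpace.norm_sq_eq, normSqV, innerV, hB, Matrix.star_eq_conjTranspose,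
      ← Matrix.mulVec_mulVec, Matrix.dotProduct_mulVec, Matrix.vecMul_conjTranspose]
    simp [dotProduct, sq]
  have hinj : Function.Injective (Matrix.toEuclideanLin B) := by
    rw [injective_iff_map_eq_zero]
    intro x hx
    by_contra hne
    have h1 : 0 < normSqV V x := by
      have := hV.inv.dotProduct_mulVec_pos (x := x.ofLp) (by simpa using hne)
      simpa [normSqV, innerV] using this
    rw [h0, hx] at h1
    simp at h1
  exact ⟨(LinearEquiv.ofInjectiveEndo _ hinj).toContinuousLinearEquiv, fun x ↦ by
    rw [h0]; rfl⟩

theorem existsUnique_isProjV {p : ℕ} {V : Matrix (Fin p) (Fin p) ℝ} (hV : V.PosDef)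
    {C : PointedCone ℝ (EuclideanSpace ℝ (Fin p))} (hC : IsPolyhedralCone C)
    (y : EuclideanSpace ℝ (Fin p)) : ∃! z, IsProjV V C y z := by
  obtain ⟨L, hL⟩ := normSqV_eq hV
  obtain ⟨k, A, hA⟩ := hC
  have hcl : IsClosed (C : Set (EuclideanSpace ℝ (Fin p))) := by
    have : (C : Set (EuclideanSpace ℝ (Fin p))) = ⋂ i, {x | 0 ≤ (A *ᵥ x.ofLp) i} := by
      ext x; simp [hA]
    rw [this]
    refine isClosed_iInter fun i ↦ isClosed_le continuous_const ?_
    unfold Matrix.mulVec dotProduct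
    fun_prop
  have hcv : Convex ℝ (C : Set (EuclideanSpace ℝ (Fin p))) := C.convex
  set K := L '' (C : Set (EuclideanSpace ℝ (Fin p))) with hK
  have hKc : IsComplete K := (L.toHomeomorph.isClosedMap _ hcl).isComplete
  have hKv : Convex ℝ K := hcv.linear_image L.toLinearEquiv.toLinearMap
  have key : ∀ z ∈ C, (IsProjV V C y z ↔ ∀ w ∈ C, inner ℝ (L y - L z) (L w - L z) ≤ 0) := by
    intro z hz
    have h1 := norm_eq_iInf_iff_real_inner_le_zero hKv (u := L y) (v := L z) ⟨z, hz, rfl⟩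
    have h2 : (∀ w ∈ K, inner ℝ (L y - L z) (w - L z) ≤ 0) ↔
        ∀ w ∈ C, inner ℝ (L y - L z) (L w - L z) ≤ 0 := by
      simp [hK]
    rw [← h2, ← h1]
    have : Nonempty K := ⟨⟨L z, z, hz, rfl⟩⟩
    have hb : BddBelow (Set.range fun w : K ↦ ‖L y - w‖) :=
      ⟨0, by rintro _ ⟨w, rfl⟩; positivity⟩
    have h3 : ∀ w, normSqV V (y - z) ≤ normSqV V (y - w) ↔ ‖L y - L z‖ ≤ ‖L y - L w‖ := by
      intro w
      rw [hL, hL, map_sub, map_sub]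
      exact pow_le_pow_iff_left₀ (norm_nonneg _) (norm_nonneg _) two_ne_zero
    constructor
    · rintro ⟨_, h⟩
      refine le_antisymm (le_ciInf ?_) (ciInf_le hb (⟨L z, z, hz, rfl⟩ : K))
      rintro ⟨_, w, hw, rfl⟩
      exact (h3 w).1 (h w hw)
    · intro h
      refine ⟨hz, fun w hw ↦ (h3 w).2 ?_⟩
      rw [h]
      exact ciInf_le hb (⟨L w, w, hw, rfl⟩ : K)
  obtain ⟨_, ⟨z, hz, rfl⟩, hmin⟩ :=
    exists_norm_eq_iInf_of_complete_convex (K := K) ⟨L 0, 0, C.zero_mem, rfl⟩ hKc hKv (L y)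
  have hz' := (norm_eq_iInf_iff_real_inner_le_zero hKv (u := L y) (v := L z) ⟨z, hz, rfl⟩).1 hmin
  have hz2 : ∀ w ∈ C, inner ℝ (L y - L z) (L w - L z) ≤ 0 := fun w hw ↦ hz' _ ⟨w, hw, rfl⟩
  refine ⟨z, (key z hz).2 hz2, fun w hw ↦ ?_⟩
  have a := hz2 w hw.1
  have b := (key w hw.1).1 hw z hz
  have c : inner ℝ (L y - L w) (L z - L w) = inner ℝ (L w - L y) (L w - L z) := by
    rw [← neg_sub (L w), ← neg_sub (L w) (L z), inner_neg_neg]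
  rw [c] at b
  have d : inner ℝ (L w - L z) (L w - L z) ≤ 0 := by
    have : L w - L z = (L y - L z) + (L w - L y) := by abel
    calc inner ℝ (L w - L z) (L w - L z)
        = inner ℝ ((L y - L z) + (L w - L y)) (L w - L z) := by rw [← this]
      _ ≤ 0 := by rw [inner_add_left]; linarith
  rw [real_inner_self_eq_norm_sq] at d
  have e : ‖L w - L z‖ = 0 := by nlinarith [norm_nonneg (L w - L z)]
  exact L.injective (sub_eq_zero.1 (norm_eq_zero.1 e))

theorem isProjV_projV {p : ℕ} {V : Matrix (Fin p) (Fin p) ℝ} (hV : V.PosDef)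
    {C : PointedCone ℝ (EuclideanSpace ℝ (Fin p))} (hC : IsPolyhedralCone C)
    (y : EuclideanSpace ℝ (Fin p)) : IsProjV V C y (projV V C y) :=
  Classical.epsilon_spec (existsUnique_isProjV hV hC y).exists

theorem mem_intrinsicInterior_cone {E : Type*} [NormedAddCommGroup E] [NormedSpace ℝ E]
    (F : PointedCone ℝ E) (x : E) :
    x ∈ intrinsicInterior ℝ (F : Set E) ↔
      x ∈ F ∧ ∃ r > 0, ∀ w ∈ Submodule.span ℝ (F : Set E), ‖w‖ < r → x + w ∈ F := by
  have haff : (affineSpan ℝ (F : Set E) : Set E) = Submodule.span ℝ (F : Set E) := by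
    have := affineSpan_insert_zero (k := ℝ) (s := (F : Set E))
    rwa [Set.insert_eq_of_mem F.zero_mem] at this
  have hm : ∀ v, v ∈ affineSpan ℝ (F : Set E) ↔ v ∈ Submodule.span ℝ (F : Set E) := by
    intro v
    rw [← SetLike.mem_coe, haff, SetLike.mem_coe]
  rw [mem_intrinsicInterior]
  constructor
  · rintro ⟨v, hv, rfl⟩
    have hv' := interior_subset hv
    refine ⟨hv', ?_⟩
    rw [mem_interior_iff_mem_nhds, Metric.mem_nhds_iff] at hv
    obtain ⟨r, hr, h⟩ := hv
    refine ⟨r, hr, fun w hw hwr ↦ ?_⟩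
    have hmem : (v : E) + w ∈ affineSpan ℝ (F : Set E) :=
      (hm _).2 (add_mem ((hm _).1 v.2) hw)
    exact @h ⟨_, hmem⟩ (by rw [Metric.mem_ball, Subtype.dist_eq, dist_eq_norm]; simpa using hwr)
  · rintro ⟨hx, r, hr, h⟩
    refine ⟨⟨x, subset_affineSpan ℝ _ hx⟩, ?_, rfl⟩
    rw [mem_interior_iff_mem_nhds, Metric.mem_nhds_iff]
    refine ⟨r, hr, fun w hw ↦ ?_⟩
    rw [Metric.mem_ball, Subtype.dist_eq, dist_eq_norm] at hw
    have := h (w - x) (sub_mem ((hm _).1 w.2) (Submodule.subset_span hx)) hw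
    simpa using this

/-- The relative interiors of the faces of a cone partition it. -/
theorem existsUnique_face {E : Type*} [NormedAddCommGroup E] [NormedSpace ℝ E]
    [FiniteDimensional ℝ E] (C : PointedCone ℝ E) {x : E} (hx : x ∈ C) :
    ∃! F : PointedCone ℝ E, F.IsFaceOf C ∧ x ∈ intrinsicInterior ℝ (F : Set E) := by
  have key : ∀ F : PointedCone ℝ E, F.IsFaceOf C → x ∈ intrinsicInterior ℝ (F : Set E) →
      ∀ G : PointedCone ℝ E, G.IsFaceOf C → x ∈ G → F ≤ G := by
    intro F hF hxF G hG hxG y hy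
    obtain ⟨hx', r, hr, h⟩ := (mem_intrinsicInterior_cone F x).1 hxF
    set ε : ℝ := r / (2 * (‖y‖ + 1)) with hε
    have hpos : 0 < ε := by positivity
    have hlt : ‖-(ε • y)‖ < r := by
      rw [norm_neg, norm_smul, Real.norm_of_nonneg hpos.le, hε, div_mul_eq_mul_div, div_lt_iff₀
        (by positivity)]
      nlinarith [norm_nonneg y]
    have h1 := h (-(ε • y)) (neg_mem (Submodule.smul_mem _ _ (Submodule.subset_span hy))) hlt
    refine hG.mem_of_smul_add_mem (hF.le hy) (hF.le h1) hpos ?_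
    simpa using hxG
  refine existsUnique_of_exists_of_unique ?_ fun F G hF hG ↦
    le_antisymm (key F hF.1 hF.2 G hG.1 (intrinsicInterior_subset hG.2))
      (key G hG.1 hG.2 F hF.1 (intrinsicInterior_subset hF.2))
  let F : PointedCone ℝ E :=
    { carrier := {y | y ∈ C ∧ ∃ ε : ℝ, 0 < ε ∧ x - ε • y ∈ C}
      zero_mem' := ⟨C.zero_mem, 1, one_pos, by simpa using hx⟩
      add_mem' := by
        rintro a b ⟨ha, s, hs, hsa⟩ ⟨hb, t, ht, htb⟩
        refine ⟨add_mem ha hb, s * t / (s + t), by positivity, ?_⟩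
        have e : x - (s * t / (s + t)) • (a + b) =
            (t / (s + t)) • (x - s • a) + (s / (s + t)) • (x - t • b) := by
          have : x = (t / (s + t)) • x + (s / (s + t)) • x := by
            rw [← add_smul, ← add_div, add_comm t s, div_self (by positivity), one_smul]
          nth_rewrite 1 [this]
          simp only [smul_sub, smul_add, smul_smul]
          rw [show t / (s + t) * s = s * t / (s + t) by ring,
            show s / (s + t) * t = s * t / (s + t) by ring]
          abel
        rw [e]
        exact add_mem (C.smul_mem (by positivity) hsa)
          (C.smul_mem (by positivity) htb)
      smul_mem' := by
        rintro ⟨c, hc⟩ a ⟨ha, s, hs, hsa⟩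
        refine ⟨C.smul_mem hc ha, s / (c + 1), by positivity, ?_⟩
        change x - (s / (c + 1)) • (c • a) ∈ C
        have e : x - (s / (c + 1)) • (c • a) =
            (c / (c + 1)) • (x - s • a) + (1 / (c + 1)) • x := by
          have : x = (c / (c + 1)) • x + (1 / (c + 1)) • x := by
            rw [← add_smul, ← add_div, div_self (by positivity), one_smul]
          nth_rewrite 1 [this]
          simp only [smul_sub, smul_smul]
          rw [show s / (c + 1) * c = c / (c + 1) * s by ring]
          abel
        rw [e]
        exact add_mem (C.smul_mem (by positivity) hsa)
          (C.smul_mem (by positivity) hx) }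
  have hmF : ∀ y, y ∈ F ↔ y ∈ C ∧ ∃ ε : ℝ, 0 < ε ∧ x - ε • y ∈ C := fun y ↦ Iff.rfl
  have hface : F.IsFaceOf C := by
    refine ⟨fun y hy ↦ ((hmF y).1 hy).1, ?_⟩
    intro y z a hy hz ha hyz
    obtain ⟨_, ε, hε, h⟩ := (hmF _).1 hyz
    refine (hmF y).2 ⟨hy, ε * a, by positivity, ?_⟩
    have := add_mem h (C.smul_mem hε.le hz)
    change x - ε • (a • y + z) + ε • z ∈ C at this
    convert this using 1
    rw [smul_add, smul_smul]
    abel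
  refine ⟨F, hface, ?_⟩
  obtain ⟨z, hz⟩ := Set.Nonempty.intrinsicInterior (s := (F : Set E)) F.convex ⟨0, F.zero_mem⟩
  obtain ⟨hzF, r, hr, h⟩ := (mem_intrinsicInterior_cone F z).1 hz
  obtain ⟨hzC, ε, hε, hxz⟩ := (hmF z).1 hzF
  have hu : x - ε • z ∈ F := by
    refine (hmF _).2 ⟨hxz, 1, one_pos, ?_⟩
    have := C.smul_mem hε.le hzC
    change ε • z ∈ C at this
    simpa using this
  have hxF : x ∈ F := (hmF x).2 ⟨hx, 1, one_pos, by simp⟩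
  refine (mem_intrinsicInterior_cone F x).2 ⟨hxF, ε * r, by positivity, fun w hw hwr ↦ ?_⟩
  have h1 := h (ε⁻¹ • w) (Submodule.smul_mem _ _ hw) (by
    rw [norm_smul, Real.norm_of_nonneg (by positivity), inv_mul_lt_iff₀ hε]
    exact hwr)
  have h2 := add_mem hu (F.smul_mem hε.le h1)
  change x - ε • z + ε • (z + ε⁻¹ • w) ∈ F at h2
  convert h2 using 1
  rw [smul_add, smul_smul, mul_inv_cancel₀ hε.ne', one_smul]
  abel

end

end ConeTest

/-! Whitening by a linear map `L` turns the `V`-inner product into the Euclidean one and `𝒩(0, V)`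
into the standard Gaussian law (`map_multivariateGaussian_eq_stdGaussian`). Fix a face `F` and let
`S` be the span of its image. By Moreau's conditions (`isProjV_iff`), the projection is a nonzero
point of ri `F` exactly when the component of `L y` in `S` lies in a cone without the origin and the
component in `Sᗮ` lies in a normal cone; the statistic is then the squared length of the first
component (`projV_mem_intrinsicInterior_and_ne_zero_iff`, `orthogonalProjection_eq_of_projV_mem`).

For a standard Gaussian vector this length is independent of its own direction and of the component
in `Sᗮ`. Conditioning on the face event therefore leaves a chi-square law with `dim S` degrees of
freedom, which exceeds its quantile with probability at most `α` (`stdGaussian_face_event_le`).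

There are finitely many face events. They are disjoint and miss the polar cone, where the projection
is `0`; there the statistic vanishes and the test never rejects. Summing over the faces gives the
factor `1 - P(Y ∈ C°)`. -/

namespace ConeTest

/-! ### Standard Gaussian vectors: norm, direction, orthogonal components; chi-square quantiles. -/

section StandardGaussian

variable {E : Type*} [NormedAddCommGroup E] [InnerProductSpace ℝ E] [FiniteDimensional ℝ E]
  [MeasurableSpace E] [BorelSpace E]

/-- The standard Gaussian measure has a density that depends on the norm only. -/
theorem exists_stdGaussian_eq_withDensity_norm :
    ∃ g : ℝ → NNReal, Measurable g ∧
      stdGaussian E = (volume : Measure E).withDensity (fun x ↦ (g ‖x‖ : ENNReal)) := by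
  have hb : (0 : ℝ) < ((1 / 2 : ℂ)).re := by norm_num
  set K : ℝ := ∫ v : E, Real.exp (-(1 / 2) * ‖v‖ ^ 2) with hK
  have hKc : (K : ℂ) = (Real.pi / (1 / 2 : ℂ)) ^ (Module.finrank ℝ E / 2 : ℂ) := by
    have h := GaussianFourier.integral_cexp_neg_mul_sq_norm_add hb 0 (0 : E)
    simp only [zero_mul, add_zero, ne_eq, OfNat.ofNat_ne_zero, not_false_eq_true, zero_pow,
      zero_div, Complex.exp_zero, mul_one] at h
    rw [← h, hK, ← integral_complex_ofReal]
    simp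
  have hK0 : (K : ℂ) ≠ 0 := by
    rw [hKc, Complex.cpow_ne_zero_iff]
    left
    simp [Real.pi_ne_zero]
  have hKpos : 0 < K := by
    have h1 : 0 ≤ K := integral_nonneg fun v ↦ (Real.exp_pos _).le
    exact lt_of_le_of_ne h1 fun h ↦ hK0 (by simp [← h])
  -- A non-integrable function has integral `0` by convention, so `K > 0` already forces
  -- integrability.
  have hint : Integrable (fun v : E ↦ Real.exp (-(1 / 2) * ‖v‖ ^ 2)) := by
    by_contra h
    exact hKpos.ne' (integral_undef h)
  set g : ℝ → NNReal := fun r ↦ Real.toNNReal (Real.exp (-(1 / 2) * r ^ 2) / K) with hg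
  have hgm : Measurable g := by fun_prop
  have hgx : ∀ r, (g r : ℝ) = Real.exp (-(1 / 2) * r ^ 2) / K := fun r ↦
    Real.coe_toNNReal _ (by positivity)
  refine ⟨g, hgm, ?_⟩
  have : IsFiniteMeasure ((volume : Measure E).withDensity (fun x ↦ (g ‖x‖ : ENNReal))) :=
    isFiniteMeasure_withDensity_ofReal (hint.div_const K).2
  apply Measure.ext_of_charFun
  ext t
  rw [charFun_stdGaussian, charFun_apply,
    integral_withDensity_eq_integral_smul (f := fun x : E ↦ g ‖x‖) (by fun_prop)]
  have h := GaussianFourier.integral_cexp_neg_mul_sq_norm_add hb Complex.I t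
  have e : ∀ x : E, g ‖x‖ • Complex.exp (inner ℝ x t * Complex.I) =
      (K : ℂ)⁻¹ * Complex.exp (-(1 / 2) * ‖x‖ ^ 2 + Complex.I * inner ℝ t x) := by
    intro x
    rw [NNReal.smul_def, hgx, Complex.real_smul, Complex.exp_add, real_inner_comm]
    push_cast
    ring_nf
  simp_rw [e]
  rw [integral_const_mul, h, ← hKc, inv_mul_cancel_left₀ hK0]
  congr 1
  rw [Complex.I_sq]
  ring

/-- The norm and the direction of a standard Gaussian vector are independent. -/
theorem stdGaussian_norm_preimage_inter_cone {T : Set ℝ} (hT : MeasurableSet T) {A : Set E}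
    (hA : MeasurableSet A) (h0 : (0 : E) ∉ A) (hcone : ∀ x ∈ A, ∀ t : ℝ, 0 < t → t • x ∈ A) :
    stdGaussian E ({x | ‖x‖ ∈ T} ∩ A) = stdGaussian E {x | ‖x‖ ∈ T} * stdGaussian E A := by
  -- In dimension zero there are no polar coordinates, but `A` is empty because it misses the
  -- origin.
  rcases subsingleton_or_nontrivial E with hE | hE
  · have : A = ∅ := Set.eq_empty_of_forall_notMem fun x hx ↦ h0 (Subsingleton.elim x 0 ▸ hx)
    simp [this]
  obtain ⟨g, hg, hγ⟩ := exists_stdGaussian_eq_withDensity_norm (E := E)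
  set σ := (volume : Measure E).toSphere
  set m : Measure (Set.Ioi (0 : ℝ)) :=
    (Measure.volumeIoiPow (Module.finrank ℝ E - 1)).withDensity (fun r ↦ (g r : ENNReal)) with hm
  set U : Set (Metric.sphere (0 : E) 1) := Subtype.val ⁻¹' A
  have hU : MeasurableSet U := measurable_subtype_coe hA
  -- Polar coordinates, defined off the null set `{0}`: a cone `B` constrains only the direction,
  -- while `T` and the density involve only the radius, so the integral splits.
  have key : ∀ (T : Set ℝ), MeasurableSet T → ∀ B : Set E, MeasurableSet B →
      (∀ x ∈ B, ∀ t : ℝ, 0 < t → t • x ∈ B) →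
      stdGaussian E ({x | ‖x‖ ∈ T} ∩ B) =
        σ ((Subtype.val : Metric.sphere (0 : E) 1 → E) ⁻¹' B) *
          m ((Subtype.val : Set.Ioi (0 : ℝ) → ℝ) ⁻¹' T) := by
    intro T hT B hB hBc
    have hTB : MeasurableSet ({x : E | ‖x‖ ∈ T} ∩ B) := (measurable_norm hT).inter hB
    rw [hγ, withDensity_apply _ hTB, ← lintegral_indicator hTB,
      ← restrict_compl_singleton (μ := (volume : Measure E)) 0,
      ← lintegral_subtype_comap (measurableSet_singleton (0 : E)).compl]
    have hmp := (volume : Measure E).measurePreserving_homeomorphUnitSphereProd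
    set W := ((Subtype.val : Metric.sphere (0 : E) 1 → E) ⁻¹' B) ×ˢ
      ((Subtype.val : Set.Ioi (0 : ℝ) → ℝ) ⁻¹' T) with hW
    have hWm : MeasurableSet W :=
      (measurable_subtype_coe hB).prod (measurable_subtype_coe hT)
    have e : ∀ x : ({(0 : E)}ᶜ : Set E),
        ({x : E | ‖x‖ ∈ T} ∩ B).indicator (fun x ↦ (g ‖x‖ : ENNReal)) x =
        W.indicator (fun z ↦ (g z.2 : ENNReal)) (homeomorphUnitSphereProd E x) := by
      intro x
      have hx : 0 < ‖(x : E)‖ := norm_pos_iff.2 x.2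
      have h2 : (x : E) ∈ {x : E | ‖x‖ ∈ T} ∩ B ↔ homeomorphUnitSphereProd E x ∈ W := by
        simp only [hW, Set.mem_prod, Set.mem_preimage, homeomorphUnitSphereProd_apply_fst_coe,
          homeomorphUnitSphereProd_apply_snd_coe, Set.mem_inter_iff, Set.mem_ofPred_eq]
        rw [and_comm]
        refine and_congr_left fun _ ↦ ⟨fun h ↦ hBc _ h _ (inv_pos.2 hx), fun h ↦ ?_⟩
        have := hBc _ h _ hx
        rwa [smul_smul, mul_inv_cancel₀ hx.ne', one_smul] at this
      by_cases h : (x : E) ∈ {x : E | ‖x‖ ∈ T} ∩ B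
      · rw [Set.indicator_of_mem h, Set.indicator_of_mem (h2.1 h),
          homeomorphUnitSphereProd_apply_snd_coe]
      · rw [Set.indicator_of_notMem h, Set.indicator_of_notMem (mt h2.2 h)]
    simp_rw [e]
    rw [hmp.lintegral_comp_emb (Homeomorph.measurableEmbedding _), lintegral_indicator hWm, hW,
      ← Measure.prod_restrict, lintegral_prod _ (by fun_prop)]
    simp only [lintegral_const, Measure.restrict_apply_univ]
    rw [mul_comm, hm, withDensity_apply _ (measurable_subtype_coe hT)]
  -- Neither `σ` nor `m` is normalized; only the product of their total masses is `1`, and this is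
  -- enough for independence.
  have huniv : σ Set.univ * m Set.univ = 1 := by
    have := key Set.univ .univ Set.univ .univ (fun _ _ _ _ ↦ trivial)
    simpa using this.symm
  have hTu := key T hT Set.univ .univ (fun _ _ _ _ ↦ trivial)
  have hAu := key Set.univ .univ A hA hcone
  rw [key T hT A hA hcone]
  simp only [Set.inter_univ, Set.preimage_univ, Set.mem_univ, Set.ofPred_true,
    Set.univ_inter] at hTu hAu
  rw [hTu, hAu, mul_mul_mul_comm, mul_comm (σ Set.univ), mul_assoc, mul_comm (m _) (m _),
    ← mul_assoc (σ Set.univ), huniv, one_mul]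

/-- The components of a standard Gaussian vector in a subspace and in its orthogonal complement
are independent standard Gaussian vectors. -/
theorem stdGaussian_map_orthogonalProjection (S : Submodule ℝ E) :
    (stdGaussian E).map (fun x ↦ (S.orthogonalProjectionOnto x, Sᗮ.orthogonalProjectionOnto x)) =
      (stdGaussian S).prod (stdGaussian Sᗮ) := by
  rw [← charFun_eq_prod_iff]
  intro t
  have e : (WithLp.toLp 2 ∘
      fun x ↦ (S.orthogonalProjectionOnto x, Sᗮ.orthogonalProjectionOnto x)) =
      S.orthogonalDecomposition := by
    ext x : 1
    simp
  rw [Measure.map_map (by fun_prop) (by fun_prop), e, stdGaussian_map, charFun_stdGaussian,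
    charFun_stdGaussian, charFun_stdGaussian, ← Complex.exp_add]
  congr 1
  have h : ‖t‖ ^ 2 = ‖t.fst‖ ^ 2 + ‖t.snd‖ ^ 2 := WithLp.prod_norm_sq_eq_of_L2 t
  have h' : (‖t‖ : ℂ) ^ 2 = (‖t.fst‖ : ℂ) ^ 2 + (‖t.snd‖ : ℂ) ^ 2 := by exact_mod_cast h
  change -(‖t‖ : ℂ) ^ 2 / 2 = -(‖t.fst‖ : ℂ) ^ 2 / 2 + -(‖t.snd‖ : ℂ) ^ 2 / 2
  rw [h']
  ring

theorem stdGaussian_norm_sq_gt (t : ℝ) :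
    stdGaussian E {x | t < ‖x‖ ^ 2} = chiSquare (Module.finrank ℝ E) (Set.Ioi t) := by
  rw [chiSquare, Measure.map_apply (by fun_prop) measurableSet_Ioi,
    ← stdGaussian_map (stdOrthonormalBasis ℝ E).repr,
    Measure.map_apply (by fun_prop) (by measurability)]
  simp [Set.preimage]

/-- For a measurable set of the form "the component in `S` lies in `A`, the orthogonal component
lies in `B`" with `A` stable under positive scalings, the event that the component in `S` is long
is independent of this set. -/
theorem stdGaussian_orthogonalProjection_norm_inter (S : Submodule ℝ E) (t : ℝ) {A : Set S}
    (hA : MeasurableSet A) (h0 : (0 : S) ∉ A) (hcone : ∀ x ∈ A, ∀ c : ℝ, 0 < c → c • x ∈ A)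
    {B : Set Sᗮ} (hB : MeasurableSet B) :
    stdGaussian E {x | t < ‖S.orthogonalProjectionOnto x‖ ^ 2 ∧
        S.orthogonalProjectionOnto x ∈ A ∧ Sᗮ.orthogonalProjectionOnto x ∈ B} =
      chiSquare (Module.finrank ℝ S) (Set.Ioi t) *
        stdGaussian E {x | S.orthogonalProjectionOnto x ∈ A ∧
          Sᗮ.orthogonalProjectionOnto x ∈ B} := by
  have key : ∀ A : Set S, MeasurableSet A →
      stdGaussian E {x | S.orthogonalProjectionOnto x ∈ A ∧ Sᗮ.orthogonalProjectionOnto x ∈ B} =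
        stdGaussian S A * stdGaussian Sᗮ B := by
    intro A hA
    rw [← Measure.prod_prod, ← stdGaussian_map_orthogonalProjection,
      Measure.map_apply (by fun_prop) (hA.prod hB)]
    rfl
  have hT : MeasurableSet {r : ℝ | t < r ^ 2} := by measurability
  -- The length condition concerns the component in `S` alone, so it is absorbed into `A` before the
  -- norm and the direction are separated.
  have h1 := key ({x | ‖x‖ ∈ {r : ℝ | t < r ^ 2}} ∩ A) ((measurable_norm hT).inter hA)
  rw [stdGaussian_norm_preimage_inter_cone hT hA h0 hcone] at h1
  rw [key A hA, ← stdGaussian_norm_sq_gt, ← mul_assoc]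
  rw [show {x : S | t < ‖x‖ ^ 2} = {x : S | ‖x‖ ∈ {r : ℝ | t < r ^ 2}} from rfl, ← h1]
  congr 1
  ext x
  simp [and_assoc]

instance isProbabilityMeasure_chiSquare (r : ℕ) : IsProbabilityMeasure (chiSquare r) :=
  Measure.isProbabilityMeasure_map (Measurable.aemeasurable (by fun_prop))

/-- Right-continuity of the cdf makes its value at the quantile at least `1 - α`. An atom, as for
zero degrees of freedom, can make the inequality strict. -/
theorem measure_Ioi_quantile_le (ν : Measure ℝ) [IsProbabilityMeasure ν] {α : ℝ} (h0 : 0 < α) :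
    ν (Set.Ioi (quantile ν (1 - α))) ≤ ENNReal.ofReal α := by
  set s : Set ℝ := {x : ℝ | 1 - α ≤ cdf ν x} with hs
  have hne : s.Nonempty :=
    ((tendsto_cdf_atTop ν).eventually (eventually_ge_nhds (by linarith : 1 - α < 1))).exists
  have hmem : 1 - α ≤ cdf ν (quantile ν (1 - α)) := by
    refine ge_of_tendsto (x := nhdsWithin (sInf s) (Set.Ioi (sInf s)))
      (((cdf ν).right_continuous (sInf s)).tendsto.mono_left
        (nhdsWithin_mono _ Set.Ioi_subset_Ici_self)) ?_
    filter_upwards [self_mem_nhdsWithin] with x hx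
    obtain ⟨y, hy, hyx⟩ := exists_lt_of_csInf_lt hne hx
    exact le_trans hy (monotone_cdf ν hyx.le)
  rw [← Set.compl_Iic, prob_compl_eq_one_sub measurableSet_Iic, ← ofReal_cdf, ← ENNReal.ofReal_one,
    ← ENNReal.ofReal_sub _ (cdf_nonneg ν _)]
  exact ENNReal.ofReal_le_ofReal (by linarith)

theorem quantile_chiSquare_nonneg (r : ℕ) {α : ℝ} (h1 : α < 1) :
    0 ≤ quantile (chiSquare r) (1 - α) := by
  refine Real.sInf_nonneg fun x hx ↦ ?_
  by_contra! hlt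
  have : cdf (chiSquare r) x = 0 := by
    rw [cdf_eq_real, measureReal_def, chiSquare, Measure.map_apply (by fun_prop) measurableSet_Iic]
    have : (fun z : EuclideanSpace ℝ (Fin r) ↦ ‖z‖ ^ 2) ⁻¹' Set.Iic x = ∅ := by
      ext z
      simp only [Set.mem_preimage, Set.mem_Iic, Set.mem_empty_iff_false, iff_false, not_le]
      exact hlt.trans_le (by positivity)
    simp [this]
  simp only [Set.mem_ofPred_eq, this] at hx
  linarith

end StandardGaussian

/-! ### Change of coordinates to the standard Gaussian. -/

section Whitening

variable {p : ℕ} {V : Matrix (Fin p) (Fin p) ℝ}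

theorem dotProduct_mulVec_comm_of_isHermitian {M : Matrix (Fin p) (Fin p) ℝ} (hM : M.IsHermitian)
    (x y : Fin p → ℝ) : x ⬝ᵥ M *ᵥ y = y ⬝ᵥ M *ᵥ x := by
  have hT : Mᵀ = M := by simpa [Matrix.IsHermitian] using hM
  rw [Matrix.dotProduct_mulVec, ← Matrix.mulVec_transpose, hT, dotProduct_comm]

/-- A linear change of coordinates turning `xᵀ V⁻¹ y` into the Euclidean inner product. -/
theorem exists_innerV_eq_inner (hV : V.PosDef) :
    ∃ L : EuclideanSpace ℝ (Fin p) ≃L[ℝ] EuclideanSpace ℝ (Fin p),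
      ∀ x y, innerV V x y = inner ℝ (L x) (L y) := by
  obtain ⟨L, hL⟩ := normSqV_eq hV
  refine ⟨L, fun x y ↦ ?_⟩
  have h1 : normSqV V (x + y) = normSqV V x + 2 * innerV V x y + normSqV V y := by
    have := dotProduct_mulVec_comm_of_isHermitian hV.inv.isHermitian y.ofLp x.ofLp
    simp only [normSqV, innerV, WithLp.ofLp_add, Matrix.mulVec_add, dotProduct_add,
      add_dotProduct, this]
    ring
  have h2 := norm_add_sq_real (L x) (L y)
  rw [hL, hL, hL, map_add] at h1
  linarith

/-- The same change of coordinates turns `𝒩(0, V)` into the standard Gaussian distribution. -/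
theorem map_multivariateGaussian_eq_stdGaussian (hV : V.PosDef)
    {L : EuclideanSpace ℝ (Fin p) ≃L[ℝ] EuclideanSpace ℝ (Fin p)}
    (hL : ∀ x y, innerV V x y = inner ℝ (L x) (L y)) :
    (multivariateGaussian 0 V).map L = stdGaussian (EuclideanSpace ℝ (Fin p)) := by
  apply Measure.ext_of_charFun
  ext t
  set u := (L : EuclideanSpace ℝ (Fin p) →L[ℝ] EuclideanSpace ℝ (Fin p)).adjoint t with hu
  have hu' : ∀ y, inner ℝ (L y) t = inner ℝ y u := fun y ↦ by
    rw [hu, ContinuousLinearMap.adjoint_inner_right]; rfl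
  have hVV : V⁻¹ * V = 1 := Matrix.nonsing_inv_mul _ hV.det_pos.ne'.isUnit
  -- With `u = L* t`, the vector `x = V u` satisfies `L x = t`, that is `L V L* = 1`; hence the
  -- variance `uᵀ V u` equals `‖t‖²`.
  set x : EuclideanSpace ℝ (Fin p) := WithLp.toLp 2 (V *ᵥ u.ofLp) with hx
  have hLx : L x = t := by
    refine ext_inner_left ℝ fun v ↦ ?_
    obtain ⟨y, rfl⟩ := L.surjective v
    rw [← hL, hu', innerV, hx, Matrix.mulVec_mulVec, hVV, Matrix.one_mulVec,
      EuclideanSpace.inner_eq_star_dotProduct, star_trivial, dotProduct_comm]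
  have hq : u.ofLp ⬝ᵥ V *ᵥ u.ofLp = ‖t‖ ^ 2 := by
    have h := hu' x
    rw [hLx, real_inner_self_eq_norm_sq, EuclideanSpace.inner_eq_star_dotProduct,
      star_trivial] at h
    exact h.symm
  rw [charFun_stdGaussian, charFun_apply, integral_map (by fun_prop) (by fun_prop)]
  simp_rw [hu']
  rw [← charFun_apply, charFun_multivariateGaussian hV.posSemidef, hq]
  simp [neg_div]

end Whitening

/-! ### Moreau's characterization of the projection and the likelihood ratio. -/

section Projection

variable {p : ℕ} {V : Matrix (Fin p) (Fin p) ℝ} {C : PointedCone ℝ (EuclideanSpace ℝ (Fin p))}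
  {L : EuclideanSpace ℝ (Fin p) ≃L[ℝ] EuclideanSpace ℝ (Fin p)}

theorem normSqV_add (hL : ∀ x y, innerV V x y = inner ℝ (L x) (L y))
    (x y : EuclideanSpace ℝ (Fin p)) :
    normSqV V (x + y) = normSqV V x + 2 * innerV V x y + normSqV V y := by
  simp only [normSqV, hL, map_add, real_inner_self_eq_norm_sq]
  exact norm_add_sq_real _ _

/-- First-order optimality: divide by `s` and let `s` tend to `0`. The bound `s < 1` lets `(1 - s) •
z` serve as a competitor in the cone. -/
theorem nonpos_of_two_mul_le_sq_mul {a b : ℝ}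
    (h : ∀ s : ℝ, 0 < s → s < 1 → 2 * s * a ≤ s ^ 2 * b) : a ≤ 0 := by
  by_contra! ha
  -- This choice gives both `s < 1` and `s * b < a`, against `2 * a ≤ s * b`.
  set s := a / (|b| + a + 1) with hs
  have hpos : 0 < |b| + a + 1 := by positivity
  have hs0 : 0 < s := by positivity
  have hs1 : s < 1 := by
    rw [hs, div_lt_one hpos]
    linarith [abs_nonneg b]
  have h1 := h s hs0 hs1
  have h2 : s * (|b| + a + 1) = a := div_mul_cancel₀ _ hpos.ne'
  have h3 : 2 * a ≤ s * b := by
    refine le_of_mul_le_mul_left ?_ hs0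
    linarith
  nlinarith [le_abs_self b]

/-- The projection on a cone is characterized by Moreau's conditions. -/
theorem isProjV_iff (hL : ∀ x y, innerV V x y = inner ℝ (L x) (L y))
    {y z : EuclideanSpace ℝ (Fin p)} :
    IsProjV V C y z ↔
      z ∈ C ∧ innerV V (y - z) z = 0 ∧ ∀ w ∈ C, innerV V (y - z) w ≤ 0 := by
  have hsmul : ∀ (c : ℝ) x w, innerV V x (c • w) = c * innerV V x w := fun c x w ↦ by
    rw [hL, hL, map_smul, real_inner_smul_right]
  have hsq : ∀ (c : ℝ) w, normSqV V (c • w) = c ^ 2 * normSqV V w := fun c w ↦ by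
    rw [normSqV, normSqV, hL, hL, map_smul, real_inner_smul_right, real_inner_smul_left]
    ring
  constructor
  · rintro ⟨hz, hmin⟩
    have hcone : ∀ w ∈ C, innerV V (y - z) w ≤ 0 := fun w hw ↦ by
      refine nonpos_of_two_mul_le_sq_mul (b := normSqV V w) fun s hs _ ↦ ?_
      have h := hmin (z + s • w) (add_mem hz (C.smul_mem hs.le hw))
      rw [show y - (z + s • w) = (y - z) + (-s) • w by rw [neg_smul]; abel,
        normSqV_add hL, hsmul, hsq] at h
      linarith
    refine ⟨hz, le_antisymm (hcone z hz) ?_, hcone⟩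
    rw [← neg_nonpos]
    refine nonpos_of_two_mul_le_sq_mul (b := normSqV V z) fun s hs hs1 ↦ ?_
    -- Shrinking `z` along its own ray gives the inequality opposite to `hcone z hz`.
    have h := hmin ((1 - s) • z) (C.smul_mem (by linarith : (0 : ℝ) ≤ 1 - s) hz)
    rw [show y - (1 - s) • z = (y - z) + s • z by rw [sub_smul, one_smul]; abel,
      normSqV_add hL, hsmul, hsq] at h
    linarith
  · rintro ⟨hz, h0, hcone⟩
    refine ⟨hz, fun w hw ↦ ?_⟩
    have h1 : innerV V (y - z) (z - w) = innerV V (y - z) z - innerV V (y - z) w := by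
      rw [hL, hL, hL, map_sub L z w, inner_sub_right]
    have h2 : 0 ≤ normSqV V (z - w) := by
      rw [normSqV, hL]
      exact real_inner_self_nonneg
    rw [show y - w = (y - z) + (z - w) by abel, normSqV_add hL]
    linarith [hcone w hw]

theorem projV_eq_iff (hV : V.PosDef) (hC : IsPolyhedralCone C)
    {y z : EuclideanSpace ℝ (Fin p)} : projV V C y = z ↔ IsProjV V C y z :=
  ⟨fun h ↦ h ▸ isProjV_projV hV hC y,
    fun h ↦ (existsUnique_isProjV hV hC y).unique (isProjV_projV hV hC y) h⟩

/-- Pythagoras: the residual `y - z` is orthogonal to the projection `z`. -/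
theorem lrStat_eq_normSqV_projV (hV : V.PosDef) (hC : IsPolyhedralCone C)
    (y : EuclideanSpace ℝ (Fin p)) : lrStat V C y = normSqV V (projV V C y) := by
  obtain ⟨L, hL⟩ := exists_innerV_eq_inner hV
  have hz := isProjV_projV hV hC y
  set z := projV V C y
  have hinf : ⨅ μ : C, normSqV V (y - μ) = normSqV V (y - z) := by
    refine le_antisymm (ciInf_le ⟨normSqV V (y - z), ?_⟩ (⟨z, hz.1⟩ : C)) (le_ciInf fun μ ↦
      hz.2 μ μ.2)
    rintro _ ⟨μ, rfl⟩
    exact hz.2 μ μ.2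
  have h := normSqV_add hL (y - z) z
  rw [sub_add_cancel, ((isProjV_iff hL).1 hz).2.1] at h
  rw [lrStat, hinf, h]
  ring

theorem projV_eq_zero_iff (hV : V.PosDef) (hC : IsPolyhedralCone C)
    {y : EuclideanSpace ℝ (Fin p)} : projV V C y = 0 ↔ y ∈ polarV V C := by
  obtain ⟨L, hL⟩ := exists_innerV_eq_inner hV
  rw [projV_eq_iff hV hC, isProjV_iff hL, polarV]
  simp [hL]

theorem isClosed_polarV (hL : ∀ x y, innerV V x y = inner ℝ (L x) (L y)) :
    IsClosed (polarV V C) := by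
  have : polarV V C = ⋂ w ∈ C, {x | inner ℝ (L x) (L w) ≤ 0} := by
    ext x
    simp [polarV, hL]
  rw [this]
  exact isClosed_biInter fun w _ ↦ isClosed_le (by fun_prop) continuous_const

end Projection

/-! ### Relative interiors and finiteness of the set of faces. -/

section Faces

theorem smul_mem_intrinsicInterior_cone {E : Type*} [NormedAddCommGroup E] [NormedSpace ℝ E]
    {F : PointedCone ℝ E} {x : E} (hx : x ∈ intrinsicInterior ℝ (F : Set E)) {c : ℝ}
    (hc : 0 < c) : c • x ∈ intrinsicInterior ℝ (F : Set E) := by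
  rw [mem_intrinsicInterior_cone] at hx ⊢
  obtain ⟨hxF, r, hr, h⟩ := hx
  refine ⟨F.smul_mem hc.le hxF, c * r, by positivity, fun w hw hwr ↦ ?_⟩
  have h1 := F.smul_mem hc.le (h (c⁻¹ • w) (Submodule.smul_mem _ _ hw) (by
    rwa [norm_smul, Real.norm_of_nonneg (by positivity), inv_mul_lt_iff₀ hc]))
  change c • (x + c⁻¹ • w) ∈ F at h1
  rwa [smul_add, smul_smul, mul_inv_cancel₀ hc.ne', one_smul] at h1

/-- A point of the relative interior of a cone can be moved slightly away from any other point of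
the cone. -/
theorem exists_sub_smul_mem_of_mem_intrinsicInterior {E : Type*} [NormedAddCommGroup E]
    [NormedSpace ℝ E] {F : PointedCone ℝ E} {x y : E}
    (hx : x ∈ intrinsicInterior ℝ (F : Set E)) (hy : y ∈ F) :
    ∃ ε : ℝ, 0 < ε ∧ x - ε • y ∈ F := by
  obtain ⟨hxF, r, hr, h⟩ := (mem_intrinsicInterior_cone F x).1 hx
  have hpos : 0 < r / (‖y‖ + 1) := by positivity
  refine ⟨r / (‖y‖ + 1), hpos, ?_⟩
  rw [sub_eq_add_neg]
  refine h _ (neg_mem (Submodule.smul_mem _ _ (Submodule.subset_span hy))) ?_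
  rw [norm_neg, norm_smul, Real.norm_of_nonneg hpos.le, div_mul_eq_mul_div,
    div_lt_iff₀ (by positivity)]
  nlinarith [norm_nonneg y]

theorem measurableSet_intrinsicInterior {E : Type*} [NormedAddCommGroup E] [NormedSpace ℝ E]
    [FiniteDimensional ℝ E] [MeasurableSpace E] [BorelSpace E] (s : Set E) :
    MeasurableSet (intrinsicInterior ℝ s) :=
  (AffineSubspace.closed_of_finiteDimensional
    (affineSpan ℝ s)).isClosedEmbedding_subtypeVal.measurableEmbedding.measurableSet_image.2
      isOpen_interior.measurableSet

variable {p : ℕ} {C : PointedCone ℝ (EuclideanSpace ℝ (Fin p))}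

/-- A polyhedral cone has finitely many faces. -/
theorem IsPolyhedralCone.finite_faces (hC : IsPolyhedralCone C) :
    Finite {F : PointedCone ℝ (EuclideanSpace ℝ (Fin p)) // F.IsFaceOf C} := by
  obtain ⟨k, A, hA⟩ := hC
  set a : Fin k → EuclideanSpace ℝ (Fin p) →ₗ[ℝ] ℝ := fun i ↦
    LinearMap.proj i ∘ₗ A.mulVecLin ∘ₗ (WithLp.linearEquiv 2 ℝ (Fin p → ℝ)).toLinearMap with ha
  replace hA : ∀ x, x ∈ C ↔ ∀ i, 0 ≤ a i x := hA
  clear_value a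
  set I : {F : PointedCone ℝ (EuclideanSpace ℝ (Fin p)) // F.IsFaceOf C} → Set (Fin k) :=
    fun F ↦ {i | ∀ x ∈ F.1, a i x = 0} with hI
  -- A face is determined by the constraints active on all of it. The sum `s` of suitable points of
  -- `G` is strictly positive on every inactive constraint, so `s - ε • z` stays in `C` for small
  -- `ε`; as `s` lies in the face `G`, so does `z`.
  have key : ∀ F G, I F = I G → F.1 ≤ G.1 := by
    intro F G hFG z hz
    have hex : ∀ i, ∃ x ∈ G.1, i ∉ I G → 0 < a i x := by
      intro i
      by_cases hi : i ∈ I G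
      · exact ⟨0, zero_mem _, fun h ↦ (h hi).elim⟩
      · simp only [hI, Set.mem_ofPred_eq, not_forall] at hi
        obtain ⟨x, hx, hne⟩ := hi
        exact ⟨x, hx, fun _ ↦ lt_of_le_of_ne ((hA x).1 (G.2.le hx) i) (Ne.symm hne)⟩
    choose x hxG hx using hex
    set s := ∑ j, x j with hs
    have hsG : s ∈ G.1 := sum_mem fun j _ ↦ hxG j
    have hspos : ∀ i ∉ I G, 0 < a i s := by
      intro i hi
      rw [hs, map_sum]
      exact Finset.sum_pos' (fun j _ ↦ (hA _).1 (G.2.le (hxG j)) i) ⟨i, Finset.mem_univ _, hx i hi⟩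
    have hev : ∀ i, ∀ᶠ ε : ℝ in nhdsWithin 0 (Set.Ioi 0), 0 ≤ a i (s - ε • z) := by
      intro i
      by_cases hi : i ∈ I G
      · have h1 : a i s = 0 := hi s hsG
        have h2 : a i z = 0 := (hFG ▸ hi : i ∈ I F) z hz
        simp [h1, h2]
      · have hlim : Filter.Tendsto (fun ε : ℝ ↦ a i (s - ε • z)) (nhds 0) (nhds (a i s)) := by
          have hc : Continuous fun ε : ℝ ↦ a i (s - ε • z) := by
            simp only [map_sub, map_smul, smul_eq_mul]
            fun_prop
          simpa using hc.tendsto 0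
        exact (hlim.mono_left nhdsWithin_le_nhds).eventually (eventually_ge_nhds (hspos i hi))
    obtain ⟨ε, hε, hεpos⟩ :=
      ((Filter.eventually_all.2 hev).and self_mem_nhdsWithin).exists
    refine G.2.mem_of_smul_add_mem (F.2.le hz) ((hA _).2 hε) hεpos ?_
    simpa using hsG
  exact Finite.of_injective I fun F G h ↦ Subtype.ext (le_antisymm (key F G h) (key G F h.symm))

end Faces

/-! ### The event that the projection falls in a given face. -/

section FaceEvents

variable {p : ℕ} {V : Matrix (Fin p) (Fin p) ℝ} {C F : PointedCone ℝ (EuclideanSpace ℝ (Fin p))}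

/-- The image of the linear span of a cone under a linear change of coordinates. -/
noncomputable def mapSpan
    (L : EuclideanSpace ℝ (Fin p) ≃L[ℝ] EuclideanSpace ℝ (Fin p))
    (F : PointedCone ℝ (EuclideanSpace ℝ (Fin p))) : Submodule ℝ (EuclideanSpace ℝ (Fin p)) :=
  (Submodule.span ℝ (F : Set (EuclideanSpace ℝ (Fin p)))).map L.toLinearEquiv.toLinearMap

/-- The nonzero points of the image of the relative interior of a cone. -/
def mapRelInterior (L : EuclideanSpace ℝ (Fin p) ≃L[ℝ] EuclideanSpace ℝ (Fin p))
    (F : PointedCone ℝ (EuclideanSpace ℝ (Fin p))) : Set (mapSpan L F) :=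
  {a | L.symm a ∈ intrinsicInterior ℝ (F : Set (EuclideanSpace ℝ (Fin p))) ∧ a ≠ 0}

/-- The normal vectors of the image of `C` that are orthogonal to the image of `F`. -/
def mapNormalCone (L : EuclideanSpace ℝ (Fin p) ≃L[ℝ] EuclideanSpace ℝ (Fin p))
    (C F : PointedCone ℝ (EuclideanSpace ℝ (Fin p))) : Set (mapSpan L F)ᗮ :=
  {b | ∀ w ∈ C, inner ℝ (b : EuclideanSpace ℝ (Fin p)) (L w) ≤ 0}

variable {L : EuclideanSpace ℝ (Fin p) ≃L[ℝ] EuclideanSpace ℝ (Fin p)}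

theorem finrank_mapSpan : Module.finrank ℝ (mapSpan L F) =
    Module.finrank ℝ (Submodule.span ℝ (F : Set (EuclideanSpace ℝ (Fin p)))) :=
  LinearEquiv.finrank_map_eq L.toLinearEquiv _

theorem mem_mapSpan {x : EuclideanSpace ℝ (Fin p)} (hx : x ∈ F) : L x ∈ mapSpan L F :=
  Submodule.mem_map_of_mem (Submodule.subset_span hx)

theorem measurableSet_mapRelInterior : MeasurableSet (mapRelInterior L F) := by
  refine MeasurableSet.inter ?_ (measurableSet_singleton _).compl
  exact (L.symm.continuous.comp continuous_subtype_val).measurable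
    (measurableSet_intrinsicInterior _)

theorem smul_mem_mapRelInterior {a : mapSpan L F} (ha : a ∈ mapRelInterior L F) {c : ℝ}
    (hc : 0 < c) : c • a ∈ mapRelInterior L F := by
  refine ⟨?_, smul_ne_zero hc.ne' ha.2⟩
  rw [Submodule.coe_smul, map_smul]
  exact smul_mem_intrinsicInterior_cone ha.1 hc

theorem measurableSet_mapNormalCone : MeasurableSet (mapNormalCone L C F) := by
  have : mapNormalCone L C F = ⋂ w ∈ C,
      {b : (mapSpan L F)ᗮ | inner ℝ (b : EuclideanSpace ℝ (Fin p)) (L w) ≤ 0} := by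
    ext b
    simp [mapNormalCone]
  rw [this]
  exact (isClosed_biInter fun w _ ↦ isClosed_le (by fun_prop) continuous_const).measurableSet

/-- On the event that the projection of `y` on `C` lies in the relative interior of the face `F`,
this projection is the orthogonal projection of `y` on the span of `F`. -/
theorem orthogonalProjection_eq_of_projV_mem (hV : V.PosDef) (hC : IsPolyhedralCone C)
    (hL : ∀ x y, innerV V x y = inner ℝ (L x) (L y)) (hF : F.IsFaceOf C)
    {y : EuclideanSpace ℝ (Fin p)}
    (hy : projV V C y ∈ intrinsicInterior ℝ (F : Set (EuclideanSpace ℝ (Fin p)))) :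
    ((mapSpan L F).orthogonalProjectionOnto (L y) : EuclideanSpace ℝ (Fin p)) =
      L (projV V C y) := by
  obtain ⟨hz, h0, hcone⟩ := (isProjV_iff hL).1 (isProjV_projV hV hC y)
  set z := projV V C y
  have hzF : z ∈ F := intrinsicInterior_subset hy
  -- The residual is orthogonal to `z` and nonpositive on both `w` and `z - ε • w`, so it vanishes
  -- on `w`.
  have horth : ∀ w ∈ F, inner ℝ (L (y - z)) (L w) = 0 := by
    intro w hw
    obtain ⟨ε, hε, h⟩ := exists_sub_smul_mem_of_mem_intrinsicInterior hy hw
    have h1 := hcone _ (hF.le h)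
    have h2 := hcone w (hF.le hw)
    rw [hL, map_sub L z, map_smul, inner_sub_right, inner_smul_right, ← hL, ← hL, h0] at h1
    rw [← hL]
    nlinarith
  refine Submodule.eq_starProjection_of_mem_orthogonal (mem_mapSpan hzF) ?_
  rw [← map_sub, Submodule.mem_orthogonal']
  rintro _ ⟨v, hv, rfl⟩
  change inner ℝ (L (y - z)) (L v) = 0
  induction hv using Submodule.span_induction with
  | mem w hw => exact horth w hw
  | zero => simp
  | add a b _ _ ha hb => rw [map_add, inner_add_right, ha, hb, add_zero]
  | smul c a _ ha => rw [map_smul, inner_smul_right, ha, mul_zero]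

/-- The event that the projection on `C` is a nonzero point of the relative interior of `F`,
in terms of the components along the span of `F` and its orthogonal complement. -/
theorem projV_mem_intrinsicInterior_and_ne_zero_iff (hV : V.PosDef) (hC : IsPolyhedralCone C)
    (hL : ∀ x y, innerV V x y = inner ℝ (L x) (L y)) (hF : F.IsFaceOf C)
    {y : EuclideanSpace ℝ (Fin p)} :
    (projV V C y ∈ intrinsicInterior ℝ (F : Set (EuclideanSpace ℝ (Fin p))) ∧ projV V C y ≠ 0) ↔
      (mapSpan L F).orthogonalProjectionOnto (L y) ∈ mapRelInterior L F ∧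
        (mapSpan L F)ᗮ.orthogonalProjectionOnto (L y) ∈ mapNormalCone L C F := by
  have hperp : ((mapSpan L F)ᗮ.orthogonalProjectionOnto (L y) : EuclideanSpace ℝ (Fin p)) =
      L y - ((mapSpan L F).orthogonalProjectionOnto (L y) : EuclideanSpace ℝ (Fin p)) :=
    Submodule.starProjection_orthogonal_val _
  constructor
  · rintro ⟨hmem, hne⟩
    have hP := orthogonalProjection_eq_of_projV_mem hV hC hL hF hmem
    refine ⟨⟨?_, fun h ↦ hne ?_⟩, fun w hw ↦ ?_⟩
    · rwa [hP, L.symm_apply_apply]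
    · rw [h, ZeroMemClass.coe_zero] at hP
      exact L.map_eq_zero_iff.1 hP.symm
    · rw [hperp, hP, ← map_sub, ← hL]
      exact ((isProjV_iff hL).1 (isProjV_projV hV hC y)).2.2 w hw
  · rintro ⟨⟨hri, hne⟩, hN⟩
    set u := (mapSpan L F).orthogonalProjectionOnto (L y)
    have huz : L (y - L.symm u) =
        ((mapSpan L F)ᗮ.orthogonalProjectionOnto (L y) : EuclideanSpace ℝ (Fin p)) := by
      rw [hperp, map_sub, L.apply_symm_apply]
    -- Moreau's conditions: `u` lies in `S` and the residual in `Sᗮ`, which gives orthogonality; the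
    -- normal cone supplies the inequality.
    have hz : projV V C y = L.symm u := by
      rw [projV_eq_iff hV hC, isProjV_iff hL]
      refine ⟨hF.le (intrinsicInterior_subset hri), ?_, fun w hw ↦ ?_⟩
      · rw [hL, huz, L.apply_symm_apply]
        exact Submodule.inner_left_of_mem_orthogonal u.2 (Subtype.prop _)
      · rw [hL, huz]
        exact hN w hw
    rw [hz]
    exact ⟨hri, fun h ↦ hne (Subtype.ext (L.symm.map_eq_zero_iff.1 h))⟩

/-- Relative interiors of distinct faces are disjoint, so one term of the sum survives. -/
theorem critVal_eq {α : ℝ} {y : EuclideanSpace ℝ (Fin p)} (hF : F.IsFaceOf C)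
    (hproj : projV V C y ∈ C)
    (hy : projV V C y ∈ intrinsicInterior ℝ (F : Set (EuclideanSpace ℝ (Fin p)))) :
    critVal V C α y = quantile (chiSquare (Module.finrank ℝ
      (Submodule.span ℝ (F : Set (EuclideanSpace ℝ (Fin p)))))) (1 - α) := by
  rw [critVal, finsum_eq_single _ ⟨F, hF⟩, if_pos hy]
  rintro ⟨G, hG⟩ hne
  refine if_neg fun h ↦ hne (Subtype.ext ?_)
  exact (existsUnique_face C hproj).unique ⟨hG, h⟩ ⟨hF, hy⟩

end FaceEvents

/-! ### Probability bounds. -/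

theorem stdGaussian_face_event_le {p : ℕ}
    {L : EuclideanSpace ℝ (Fin p) ≃L[ℝ] EuclideanSpace ℝ (Fin p)}
    (C F : PointedCone ℝ (EuclideanSpace ℝ (Fin p))) {α : ℝ} (hα : 0 < α) :
    stdGaussian (EuclideanSpace ℝ (Fin p)) {x |
      quantile (chiSquare (Module.finrank ℝ
        (Submodule.span ℝ (F : Set (EuclideanSpace ℝ (Fin p)))))) (1 - α) <
          ‖(mapSpan L F).orthogonalProjectionOnto x‖ ^ 2 ∧
        (mapSpan L F).orthogonalProjectionOnto x ∈ mapRelInterior L F ∧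
        (mapSpan L F)ᗮ.orthogonalProjectionOnto x ∈ mapNormalCone L C F} ≤
      ENNReal.ofReal α * stdGaussian (EuclideanSpace ℝ (Fin p)) {x |
        (mapSpan L F).orthogonalProjectionOnto x ∈ mapRelInterior L F ∧
        (mapSpan L F)ᗮ.orthogonalProjectionOnto x ∈ mapNormalCone L C F} := by
  -- The face event is a cone condition in `S` and a condition in `Sᗮ`, so the chi-square tail
  -- factors out exactly.
  rw [stdGaussian_orthogonalProjection_norm_inter (mapSpan L F) _ measurableSet_mapRelInterior
    (fun h ↦ h.2 rfl) (fun x hx c hc ↦ smul_mem_mapRelInterior hx hc) measurableSet_mapNormalCone,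
    finrank_mapSpan]
  gcongr
  exact measure_Ioi_quantile_le _ hα

/-- Under the null hypothesis, the test with the random critical value rejects with probability at
most `α` times the probability that `Y` is not in the polar cone. -/
theorem measureReal_critVal_lt_lrStat_le {p : ℕ} {V : Matrix (Fin p) (Fin p) ℝ} (hV : V.PosDef)
    {C : PointedCone ℝ (EuclideanSpace ℝ (Fin p))} (hC : IsPolyhedralCone C)
    {α : ℝ} (hα₀ : 0 < α) (hα₁ : α < 1)
    {Ω : Type*} [MeasurableSpace Ω] {P : Measure Ω} [IsProbabilityMeasure P]
    {Y : Ω → EuclideanSpace ℝ (Fin p)} (hY : HasLaw Y (multivariateGaussian 0 V) P) :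
    P.real {ω | critVal V C α (Y ω) < lrStat V C (Y ω)} ≤
      (1 - P.real {ω | Y ω ∈ polarV V C}) * α := by
  obtain ⟨L, hL⟩ := exists_innerV_eq_inner hV
  have := hC.finite_faces
  let 𝓕 := {F : PointedCone ℝ (EuclideanSpace ℝ (Fin p)) // F.IsFaceOf C}
  have : Fintype 𝓕 := Fintype.ofFinite _
  have hWm : AEMeasurable (fun ω ↦ L (Y ω)) P := L.continuous.measurable.comp_aemeasurable
    hY.aemeasurable
  have hW : P.map (fun ω ↦ L (Y ω)) = stdGaussian (EuclideanSpace ℝ (Fin p)) := by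
    rw [← map_multivariateGaussian_eq_stdGaussian hV hL, ← hY.map_eq,
      AEMeasurable.map_map_of_aemeasurable L.continuous.aemeasurable hY.aemeasurable]
    rfl
  let face : 𝓕 → Set (EuclideanSpace ℝ (Fin p)) := fun F ↦
    {x | (mapSpan L F.1).orthogonalProjectionOnto x ∈ mapRelInterior L F.1 ∧
      (mapSpan L F.1)ᗮ.orthogonalProjectionOnto x ∈ mapNormalCone L C F.1}
  let rej : 𝓕 → Set (EuclideanSpace ℝ (Fin p)) := fun F ↦
    {x | quantile (chiSquare (Module.finrank ℝ
      (Submodule.span ℝ (F.1 : Set (EuclideanSpace ℝ (Fin p)))))) (1 - α) <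
        ‖(mapSpan L F.1).orthogonalProjectionOnto x‖ ^ 2 ∧
      (mapSpan L F.1).orthogonalProjectionOnto x ∈ mapRelInterior L F.1 ∧
      (mapSpan L F.1)ᗮ.orthogonalProjectionOnto x ∈ mapNormalCone L C F.1}
  have hface : ∀ F, MeasurableSet (face F) := fun F ↦
    ((by fun_prop : Measurable fun x ↦ (mapSpan L F.1).orthogonalProjectionOnto x)
      measurableSet_mapRelInterior).inter
    ((by fun_prop : Measurable fun x ↦ (mapSpan L F.1)ᗮ.orthogonalProjectionOnto x)
      measurableSet_mapNormalCone)
  have hrej : ∀ F, MeasurableSet (rej F) := fun F ↦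
    (measurableSet_lt (g := fun x ↦ ‖(mapSpan L F.1).orthogonalProjectionOnto x‖ ^ 2)
      measurable_const (by fun_prop)).inter (hface F)
  -- An inclusion suffices, so measurability of the rejection event plays no role.
  have hsub : {ω | critVal V C α (Y ω) < lrStat V C (Y ω)} ⊆
      ⋃ F, (fun ω ↦ L (Y ω)) ⁻¹' rej F := by
    intro ω hω
    have hz := (isProjV_projV hV hC (Y ω)).1
    obtain ⟨F, ⟨hF, hri⟩, -⟩ := existsUnique_face C hz
    have hω' : critVal V C α (Y ω) < lrStat V C (Y ω) := hω
    rw [critVal_eq hF hz hri, lrStat_eq_normSqV_projV hV hC] at hω'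
    -- At projection `0` the statistic is `0`, and it cannot exceed a nonnegative quantile.
    have hne : projV V C (Y ω) ≠ 0 := fun h ↦ by
      rw [h, normSqV, hL, map_zero, inner_zero_left] at hω'
      exact hω'.not_ge (quantile_chiSquare_nonneg _ hα₁)
    refine Set.mem_iUnion.2 ⟨⟨F, hF⟩, ?_,
      (projV_mem_intrinsicInterior_and_ne_zero_iff hV hC hL hF).1 ⟨hri, hne⟩⟩
    rwa [Submodule.coe_norm, orthogonalProjection_eq_of_projV_mem hV hC hL hF hri,
      ← real_inner_self_eq_norm_sq, ← hL]
  have hdisj : Pairwise (Function.onFun Disjoint fun F ↦ (fun ω ↦ L (Y ω)) ⁻¹' face F) := by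
    intro F G hFG
    refine Set.disjoint_left.2 fun ω h1 h2 ↦ hFG (Subtype.ext ?_)
    have h1' := (projV_mem_intrinsicInterior_and_ne_zero_iff hV hC hL F.2).2 h1
    have h2' := (projV_mem_intrinsicInterior_and_ne_zero_iff hV hC hL G.2).2 h2
    exact (existsUnique_face C (isProjV_projV hV hC (Y ω)).1).unique ⟨F.2, h1'.1⟩ ⟨G.2, h2'.1⟩
  have hunion : (⋃ F, (fun ω ↦ L (Y ω)) ⁻¹' face F) ⊆ {ω | Y ω ∈ polarV V C}ᶜ := by
    refine Set.iUnion_subset fun F ω h hω ↦ ?_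
    exact ((projV_mem_intrinsicInterior_and_ne_zero_iff hV hC hL F.2).2 h).2
      ((projV_eq_zero_iff hV hC).2 hω)
  have hpolar : NullMeasurableSet {ω | Y ω ∈ polarV V C} P :=
    hY.aemeasurable.nullMeasurableSet_preimage (isClosed_polarV hL).measurableSet
  have hle : P {ω | critVal V C α (Y ω) < lrStat V C (Y ω)} ≤
      ENNReal.ofReal α * P {ω | Y ω ∈ polarV V C}ᶜ := calc
    _ ≤ P (⋃ F, (fun ω ↦ L (Y ω)) ⁻¹' rej F) := measure_mono hsub
    _ ≤ ∑ F, P ((fun ω ↦ L (Y ω)) ⁻¹' rej F) := measure_iUnion_fintype_le _ _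
    _ ≤ ∑ F, ENNReal.ofReal α * P ((fun ω ↦ L (Y ω)) ⁻¹' face F) := by
      refine Finset.sum_le_sum fun F _ ↦ ?_
      rw [← Measure.map_apply_of_aemeasurable hWm (hrej F),
        ← Measure.map_apply_of_aemeasurable hWm (hface F), hW]
      exact stdGaussian_face_event_le C F.1 hα₀
    -- Disjointness turns the sum back into one probability, so the number of faces does not enter
    -- the bound.
    _ = ENNReal.ofReal α * P (⋃ F, (fun ω ↦ L (Y ω)) ⁻¹' face F) := by
      rw [← Finset.mul_sum, measure_iUnion₀ (fun F G h ↦ (hdisj h).aedisjoint)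
        (fun F ↦ hWm.nullMeasurableSet_preimage (hface F)), tsum_fintype]
    _ ≤ _ := by gcongr
  have h := ENNReal.toReal_mono (by finiteness) hle
  rw [ENNReal.toReal_mul, ENNReal.toReal_ofReal hα₀.le, ← measureReal_def, ← measureReal_def,
    probReal_compl_eq_one_sub₀ hpolar] at h
  rwa [mul_comm]

end ConeTest

theorem mainTheorem4 {p : ℕ} (V : Matrix (Fin p) (Fin p) ℝ) (hV : V.PosDef)
    (C : PointedCone ℝ (EuclideanSpace ℝ (Fin p))) (hC : ConeTest.IsPolyhedralCone C)
    (α : ℝ) (hα₀ : 0 < α) (hα₁ : α < 1)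
    {Ω : Type*} [MeasurableSpace Ω] (P : Measure Ω) [IsProbabilityMeasure P]
    (Y : Ω → EuclideanSpace ℝ (Fin p)) (hY : HasLaw Y (multivariateGaussian 0 V) P) :
    (∀ y, ConeTest.lrStat V C y = ConeTest.normSqV V (ConeTest.projV V C y)) ∧
    P.real {ω | ConeTest.critVal V C α (Y ω) < ConeTest.lrStat V C (Y ω)} ≤
      (1 - P.real {ω | Y ω ∈ ConeTest.polarV V C}) * α ∧
    (1 - P.real {ω | Y ω ∈ ConeTest.polarV V C}) * α ≤ α := by
  refine ⟨ConeTest.lrStat_eq_normSqV_projV hV hC,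
    ConeTest.measureReal_critVal_lt_lrStat_le hV hC hα₀ hα₁ hY, ?_⟩
  exact mul_le_of_le_one_left hα₀.le (sub_le_self _ measureReal_nonneg)
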